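/- Let $\mathcal P=(\mathbf x,\mathbf r)$ be a group presentation, where $\mathbf r$ is a subset of the free group $F$ on $\mathbf x$, let $G=F/\langle\langle \mathbf r\rangle\rangle$ be the group it presents, fix $r_0\in\mathbf r$ and put $\mathbf r_1=\mathbf r\setminus\{r_0\}$. Let $Y\cup Y^{-1}$ be the set of formal symbols $({}^{u}r)^{\varepsilon}$ with $u\in F$, $r\in\mathbf r$, $\varepsilon=\pm1$. For such a symbol $a=({}^{u}r)^{\varepsilon}$ put $a^{-1}=({}^{u}r)^{-\varepsilon}$, $\theta(a)=ur^{\varepsilon}u^{-1}\in F$, and ${}^{w}a=({}^{wu}r)^{\varepsilon}$ for $w\in F$. Let $\Upsilon$ be the monoid with generating set $Y\cup Y^{-1}$ and defining relations $ab={}^{\theta(a)}b\,a$ for all $a,b\in Y\cup Y^{-1}$, let $\sigma$ be the canonical homomorphism from the free monoid on $Y\cup Y^{-1}$ onto $\Upsilon$, let $\mathcal G(\Upsilon)$ be the universal enveloping group of $\Upsilon$ (the group given by the same generators and relations), and let $\mu:\Upsilon\to\mathcal G(\Upsilon)$ be the canonical homomorphism. Let $Y_1\cup Y_1^{-1}$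 be the set of those symbols $({}^{u}r)^{\varepsilon}$ with $r\in\mathbf r_1$, and let $\hat{\mathfrak A}_1$ be the subgroup of $\mathcal G(\Upsilon)$ generated by all elements $\mu\sigma(bb^{-1})$ with $b\in Y_1\cup Y_1^{-1}$. If $\mathcal P$ is aspherical, that is, if the geometric realisation $K(\mathcal P)$ of $\mathcal P$ (the 2-dimensional CW-complex with one vertex, one loop for each element of $\mathbf x$, and one 2-cell for each $r\in\mathbf r$, attached along $r$) satisfies $\pi_2(K(\mathcal P))=0$, then $\hat{\mathfrak A}_1$ is a free abelian group with a basis equipotent to the set $G\times\mathbf r_1$. -/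

import Mathlib

universe u

/-! ### The geometric realisation of a group presentation and asphericity

A group presentation is a type `X` of generators together with a set `r` of relators in the free
group on `X`; the group it presents is `PresentedGroup r`. -/

namespace GroupPres

/-- Gluing of the end points of the edges, one for each generator, to a single vertex. -/
inductive GlueOne (X : Type u) :
    Unit ⊕ (Σ _ : X, unitInterval) → Unit ⊕ (Σ _ : X, unitInterval) → Prop
  | source (x : X) : GlueOne X (Sum.inr ⟨x, 0⟩) (Sum.inl ())
  | target (x : X) : GlueOne X (Sum.inr ⟨x, 1⟩) (Sum.inl ())

/-- The 1-skeleton: one vertex and one loop for each generator, with the quotient topology. -/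
abbrev OneSkeleton (X : Type u) : Type u := Quot (GlueOne X)

/-- The vertex of the 1-skeleton. -/
def vertex (X : Type u) : OneSkeleton X := Quot.mk _ (Sum.inl ())

/-- The loop of a generator. -/
def edgeLoop {X : Type u} (x : X) : Path (vertex X) (vertex X) where
  toFun t := Quot.mk _ (Sum.inr ⟨x, t⟩)
  continuous_toFun := by
    exact continuous_quot_mk.comp (continuous_inr.comp continuous_sigmaMk)
  source' := Quot.sound (GlueOne.source x)
  target' := Quot.sound (GlueOne.target x)

/-- The loop spelled by a word; the letter `(x, true)` is the generator `x` and the letter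
`(x, false)` is its inverse. -/
noncomputable def wordLoop {X : Type u} : List (X × Bool) → Path (vertex X) (vertex X)
  | [] => Path.refl _
  | (x, true) :: w => (edgeLoop x).trans (wordLoop w)
  | (x, false) :: w => (edgeLoop x).symm.trans (wordLoop w)

open Classical in
/-- The attaching loop of an element of the free group, spelled by its reduced word. -/
noncomputable def attachLoop {X : Type u} (w : FreeGroup X) : Path (vertex X) (vertex X) :=
  wordLoop w.toWord

/-- Gluing of one closed unit disc for each relator `ρ` to the 1-skeleton: the boundary point
`exp (2 π i t)` is glued to the point with parameter `t` of the attaching loop of `ρ`. -/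
inductive GlueTwo {X : Type u} (r : Set (FreeGroup X)) :
    OneSkeleton X ⊕ (Σ _ : r, Metric.closedBall (0 : ℂ) 1) →
      OneSkeleton X ⊕ (Σ _ : r, Metric.closedBall (0 : ℂ) 1) → Prop
  | glue (ρ : r) (t : unitInterval) (z : Metric.closedBall (0 : ℂ) 1)
      (hz : (z : ℂ) = Complex.exp (2 * Real.pi * Complex.I * ((t : ℝ) : ℂ))) :
      GlueTwo r (Sum.inr ⟨ρ, z⟩) (Sum.inl (attachLoop (ρ : FreeGroup X) t))

/-- The geometric realisation of the presentation, a connected 2-dimensional CW-complex with one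
vertex, a 1-cell for each generator and a 2-cell for each relator. -/
abbrev Realisation {X : Type u} (r : Set (FreeGroup X)) : Type u := Quot (GlueTwo r)

/-- The vertex of the geometric realisation. -/
def baseVertex {X : Type u} (r : Set (FreeGroup X)) : Realisation r :=
  Quot.mk _ (Sum.inl (vertex X))

/-- The presentation is aspherical: the second homotopy group of its geometric realisation
is trivial. -/
def IsAspherical {X : Type u} (r : Set (FreeGroup X)) : Prop :=
  Subsingleton (HomotopyGroup.Pi 2 (Realisation r) (baseVertex r))

/-! ### Universal enveloping groups of monoids given by presentations -/

/-- The inclusion of the free monoid on `A` into the free group on `A`. -/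
def wordToGroup (A : Type u) : FreeMonoid A →* FreeGroup A := FreeMonoid.lift FreeGroup.of

/-- The group relators `u * v⁻¹` coming from the monoid relations `u = v`. -/
def hatRel {A : Type u} (R : FreeMonoid A → FreeMonoid A → Prop) : Set (FreeGroup A) :=
  {w | ∃ p q : FreeMonoid A, R p q ∧ w = wordToGroup A p * (wordToGroup A q)⁻¹}

/-- The universal enveloping group of the monoid `PresentedMonoid R`. -/
abbrev EnvelopingGroup {A : Type u} (R : FreeMonoid A → FreeMonoid A → Prop) : Type u :=
  PresentedGroup (hatRel R)

/-- The canonical homomorphism from a presented monoid to its universal enveloping group; it sends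
the class of a generator to the class of the same generator. -/
def toEnvelopingGroup {A : Type u} (R : FreeMonoid A → FreeMonoid A → Prop) :
    PresentedMonoid R →* EnvelopingGroup R :=
  PresentedMonoid.lift (fun a => (PresentedGroup.of a : EnvelopingGroup R)) (by
    intro p q h
    have key : ∀ w : FreeMonoid A,
        FreeMonoid.lift (fun a => (PresentedGroup.of a : EnvelopingGroup R)) w
          = PresentedGroup.mk (hatRel R) (wordToGroup A w) := by
      intro w
      refine DFunLike.congr_fun (?_ : FreeMonoid.lift _ =
        (PresentedGroup.mk (hatRel R)).comp (wordToGroup A)) w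
      ext a
      simp [wordToGroup, PresentedGroup.of]
    rw [key, key]
    have h1 : PresentedGroup.mk (hatRel R) (wordToGroup A p * (wordToGroup A q)⁻¹) = 1 :=
      PresentedGroup.one_of_mem ⟨p, q, h, rfl⟩
    rwa [map_mul, map_inv, mul_inv_eq_one] at h1)

/-! ### Signed symbols, the monoid `Υ` and its enveloping group -/

/-- The elements of `Y ∪ Y⁻¹`: the formal symbols `(ᵘρ)^ε`, where `u` lies in the free group, `ρ` is
a relator and `ε = ±1`. -/
structure SignedSymbol {X : Type u} (r : Set (FreeGroup X)) : Type u where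
  /-- the element `u` of the free group -/
  conj : FreeGroup X
  /-- the relator `ρ` -/
  rel : r
  /-- the exponent `ε` -/
  sign : ℤˣ

namespace SignedSymbol

variable {X : Type u} {r : Set (FreeGroup X)}

/-- The formal inverse `(ᵘρ)^(-ε)` of the symbol `(ᵘρ)^ε`. -/
def inv (a : SignedSymbol r) : SignedSymbol r := ⟨a.conj, a.rel, -a.sign⟩

/-- `θ ((ᵘρ)^ε) = u ρ^ε u⁻¹`. -/
def theta (a : SignedSymbol r) : FreeGroup X :=
  a.conj * (a.rel : FreeGroup X) ^ (a.sign : ℤ) * a.conj⁻¹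

/-- The action of the free group on symbols, `ʷ((ᵘρ)^ε) = (ʷᵘρ)^ε`. -/
def act (w : FreeGroup X) (a : SignedSymbol r) : SignedSymbol r := ⟨w * a.conj, a.rel, a.sign⟩

end SignedSymbol

/-- The defining relations `a b = (^θ(a) b) a` of the monoid `Υ`. -/
inductive UpsilonRel {X : Type u} (r : Set (FreeGroup X)) :
    FreeMonoid (SignedSymbol r) → FreeMonoid (SignedSymbol r) → Prop
  | exchange (a b : SignedSymbol r) :
      UpsilonRel r (FreeMonoid.of a * FreeMonoid.of b)
        (FreeMonoid.of (SignedSymbol.act a.theta b) * FreeMonoid.of a)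

/-- The monoid `Υ` of a presentation. -/
abbrev Upsilon {X : Type u} (r : Set (FreeGroup X)) : Type u := PresentedMonoid (UpsilonRel r)

/-- The universal enveloping group `𝒢(Υ)`. -/
abbrev GUpsilon {X : Type u} (r : Set (FreeGroup X)) : Type u := EnvelopingGroup (UpsilonRel r)

/-- The canonical homomorphism `σ` from the free monoid on `Y ∪ Y⁻¹` onto `Υ`. -/
def sigma {X : Type u} (r : Set (FreeGroup X)) : FreeMonoid (SignedSymbol r) →* Upsilon r :=
  PresentedMonoid.mk (UpsilonRel r)

/-- The canonical homomorphism `μ` from `Υ` to `𝒢(Υ)`. -/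
def mu {X : Type u} (r : Set (FreeGroup X)) : Upsilon r →* GUpsilon r :=
  toEnvelopingGroup (UpsilonRel r)

/-- The subgroup of `𝒢(Υ)` generated by the elements `μσ(b b⁻¹)`, where `b` runs over the signed
symbols `(ᵘρ)^ε` whose relator `ρ` lies in the subset `r₁` of `r`. -/
def hatA {X : Type u} (r r₁ : Set (FreeGroup X)) : Subgroup (GUpsilon r) :=
  Subgroup.closure {g | ∃ b : SignedSymbol r, (b.rel : FreeGroup X) ∈ r₁ ∧
    g = mu r (sigma r (FreeMonoid.of b * FreeMonoid.of b.inv))}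

end GroupPres

/-! The defining relations say that the class of a symbol `a` semiconjugates the class of `b` to
that of `^θ(a) b`. Since `θ(b) θ(b⁻¹) = 1`, the class of `b b⁻¹` is central; hence it agrees with
the class of `b⁻¹ b` and does not change when `θ(a)` acts on `b`. So it depends only on the relator
of `b` and on the image in `G` of its conjugator. Conversely, for each `(g, ρ) ∈ G × r`, the
defining relations preserve the number of positive symbols lying over `(g, ρ)`. This count takes the
class of `b b⁻¹` to a basis element, so distinct classes are independent. -/

open scoped IsMulCommutative in
theorem nonempty_closure_range_addEquiv_freeAbelianGroup {Γ ι : Type*} [Group Γ] {f : ι → Γ}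
    (hf : ∀ i j, Commute (f i) (f j)) (χ : Γ →* Multiplicative (FreeAbelianGroup ι))
    (hχ : ∀ i, χ (f i) = Multiplicative.ofAdd (FreeAbelianGroup.of i)) :
    Nonempty (Additive (Subgroup.closure (Set.range f)) ≃+ FreeAbelianGroup ι) := by
  let H := Subgroup.closure (Set.range f)
  have : IsMulCommutative H := Subgroup.isMulCommutative_closure <| by
    rintro _ ⟨i, rfl⟩ _ ⟨j, rfl⟩
    exact hf i j
  let gen (i : ι) : H := ⟨f i, Subgroup.subset_closure ⟨i, rfl⟩⟩
  let count : H →* Multiplicative (FreeAbelianGroup ι) := χ.comp H.subtype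
  let spread : FreeAbelianGroup ι →+ Additive H :=
    FreeAbelianGroup.lift fun i => Additive.ofMul (gen i)
  have count_gen (i : ι) : count (gen i) = Multiplicative.ofAdd (FreeAbelianGroup.of i) := hχ i
  have spread_of (i : ι) : spread (FreeAbelianGroup.of i) = Additive.ofMul (gen i) :=
    FreeAbelianGroup.lift_apply_of _ i
  have count_spread : count.toAdditiveLeft.comp spread = AddMonoidHom.id _ :=
    FreeAbelianGroup.lift_ext _ _ fun i => by simp [spread_of, count_gen]
  have spread_count : spread.toMultiplicativeLeft.comp count = MonoidHom.id H :=
    MonoidHom.eq_of_eqOn_dense Subgroup.closure_closure_coe_preimage <| by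
      rintro ⟨_, _⟩ ⟨i, rfl⟩
      exact (congrArg spread (count_gen i)).trans (spread_of i)
  exact ⟨AddMonoidHom.toAddEquiv count.toAdditiveLeft spread
    (congrArg MonoidHom.toAdditive spread_count) count_spread⟩

theorem nonempty_closure_range_comp_addEquiv_freeAbelianGroup {Γ ι κ : Type*} [Group Γ] {f : κ → Γ}
    (hf : ∀ i j, Commute (f i) (f j)) (χ : Γ →* Multiplicative (FreeAbelianGroup κ))
    (hχ : ∀ k, χ (f k) = Multiplicative.ofAdd (FreeAbelianGroup.of k)) {e : ι → κ}
    (he : Function.Injective e) :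
    Nonempty (Additive (Subgroup.closure (Set.range (f ∘ e))) ≃+ FreeAbelianGroup ι) := by
  let retract : FreeAbelianGroup κ →+ FreeAbelianGroup ι :=
    FreeAbelianGroup.lift (Function.extend e FreeAbelianGroup.of 0)
  have retract_of (i : ι) : retract (FreeAbelianGroup.of (e i)) = FreeAbelianGroup.of i := by
    rw [FreeAbelianGroup.lift_apply_of, he.extend_apply]
  refine nonempty_closure_range_addEquiv_freeAbelianGroup (fun i j => hf (e i) (e j))
    (retract.toMultiplicative.comp χ) fun i => ?_
  calc retract.toMultiplicative (χ (f (e i)))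
      = Multiplicative.ofAdd (retract (FreeAbelianGroup.of (e i))) := by rw [hχ]; rfl
    _ = Multiplicative.ofAdd (FreeAbelianGroup.of i) := by rw [retract_of]

namespace GroupPres

variable {X : Type u} {r : Set (FreeGroup X)}

namespace SignedSymbol

theorem inv_inv (b : SignedSymbol r) : b.inv.inv = b := by
  simp [inv]

theorem act_act (v w : FreeGroup X) (b : SignedSymbol r) : (b.act w).act v = b.act (v * w) := by
  simp [act, mul_assoc]

theorem act_one (b : SignedSymbol r) : b.act 1 = b := by
  simp [act]

theorem theta_mul_theta_inv (b : SignedSymbol r) : b.theta * b.inv.theta = 1 := by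
  simp [theta, inv]

theorem mk_theta (a : SignedSymbol r) : PresentedGroup.mk r a.theta = 1 := by
  simp [theta, PresentedGroup.one_of_mem a.rel.2]

end SignedSymbol

/-- The generator `μσ(a)` of `𝒢(Υ)` given by the signed symbol `a`. -/
def symbolClass (a : SignedSymbol r) : GUpsilon r := PresentedGroup.of a

/-- The element `μσ(b b⁻¹)` of `𝒢(Υ)`; these elements with the relator of `b` in `r₁` generate
`hatA r r₁`. -/
def cancelClass (b : SignedSymbol r) : GUpsilon r := symbolClass b * symbolClass b.inv

theorem semiconjBy_symbolClass (a b : SignedSymbol r) :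
    SemiconjBy (symbolClass a) (symbolClass b) (symbolClass (b.act a.theta)) :=
  mul_inv_eq_one.mp <| PresentedGroup.one_of_mem ⟨_, _, UpsilonRel.exchange a b, rfl⟩

theorem commute_cancelClass_symbolClass (b c : SignedSymbol r) :
    Commute (cancelClass b) (symbolClass c) := by
  have h := (semiconjBy_symbolClass b (c.act b.inv.theta)).mul_left
    (semiconjBy_symbolClass b.inv c)
  rwa [SignedSymbol.act_act, SignedSymbol.theta_mul_theta_inv, SignedSymbol.act_one] at h

theorem commute_cancelClass (b : SignedSymbol r) (g : GUpsilon r) : Commute (cancelClass b) g := by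
  have of_mem (c : SignedSymbol r) :
      PresentedGroup.of c ∈ Subgroup.centralizer {cancelClass b} :=
    Subgroup.mem_centralizer_singleton_iff.mpr (commute_cancelClass_symbolClass b c).symm.eq
  have g_mem := PresentedGroup.generated_by _ (Subgroup.centralizer {cancelClass b}) of_mem g
  exact (Subgroup.mem_centralizer_singleton_iff.mp g_mem).symm

theorem cancelClass_inv (b : SignedSymbol r) : cancelClass b.inv = cancelClass b := by
  have h : symbolClass b * symbolClass b.inv * symbolClass b =
      symbolClass b * (symbolClass b * symbolClass b.inv) := commute_cancelClass b (symbolClass b)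
  rw [mul_assoc] at h
  rw [cancelClass, SignedSymbol.inv_inv, mul_left_cancel h, cancelClass]

theorem cancelClass_act_theta (a b : SignedSymbol r) :
    cancelClass (b.act a.theta) = cancelClass b := by
  have h : SemiconjBy (symbolClass a) (cancelClass b) (cancelClass (b.act a.theta)) :=
    (semiconjBy_symbolClass a b).mul_right (semiconjBy_symbolClass a b.inv)
  exact mul_right_cancel (h.eq.symm.trans (commute_cancelClass b _).symm.eq)

theorem cancelClass_act {n : FreeGroup X} (hn : PresentedGroup.mk r n = 1) (b : SignedSymbol r) :
    cancelClass (b.act n) = cancelClass b := by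
  rw [PresentedGroup.mk_eq_one_iff] at hn
  induction hn using Subgroup.closure_induction generalizing b with
  | mem x hx =>
    obtain ⟨ρ, hρ, hconj⟩ := Group.mem_conjugatesOfSet_iff.mp hx
    obtain ⟨u, rfl⟩ := isConj_iff.mp hconj
    simpa [SignedSymbol.theta] using cancelClass_act_theta ⟨u, ⟨ρ, hρ⟩, 1⟩ b
  | one => rw [SignedSymbol.act_one]
  | mul x y _ _ hx hy => rw [← SignedSymbol.act_act, hx, hy]
  | inv x _ hx => rw [← hx (b.act x⁻¹), SignedSymbol.act_act, mul_inv_cancel, SignedSymbol.act_one]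

/-- The common value of `cancelClass` on the symbols `(ᵘρ)^ε` with `u` representing `g`, for a pair
`p = (g, ρ)`; it is defined through a chosen representative of `g`. -/
noncomputable def cosetCancelClass (p : PresentedGroup r × r) : GUpsilon r :=
  cancelClass ⟨Function.surjInv (PresentedGroup.mk_surjective r) p.1, p.2, 1⟩

theorem cosetCancelClass_mk (b : SignedSymbol r) :
    cosetCancelClass (PresentedGroup.mk r b.conj, b.rel) = cancelClass b := by
  obtain ⟨u, ρ, ε⟩ := b
  set v := Function.surjInv (PresentedGroup.mk_surjective r) (PresentedGroup.mk r u)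
  have mk_v : PresentedGroup.mk r v = PresentedGroup.mk r u := Function.surjInv_eq _ _
  have positive : cosetCancelClass (PresentedGroup.mk r u, ρ) = cancelClass ⟨u, ρ, 1⟩ := by
    have mk_mul_inv : PresentedGroup.mk r (v * u⁻¹) = 1 := by
      rw [map_mul, mk_v, map_inv, mul_inv_cancel]
    have h := cancelClass_act mk_mul_inv ⟨u, ρ, 1⟩
    rwa [SignedSymbol.act, inv_mul_cancel_right] at h
  rcases Int.units_eq_one_or ε with rfl | rfl
  · exact positive
  · exact positive.trans (cancelClass_inv ⟨u, ρ, 1⟩).symm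

theorem hatA_eq_closure_range {r₁ : Set (FreeGroup X)} (hr₁ : r₁ ⊆ r) :
    hatA r r₁ = Subgroup.closure
      (Set.range (cosetCancelClass ∘ Prod.map id (Set.inclusion hr₁))) := by
  refine congrArg Subgroup.closure (Set.ext fun g => ⟨?_, ?_⟩)
  · rintro ⟨b, hb, rfl⟩
    exact ⟨(PresentedGroup.mk r b.conj, ⟨b.rel, hb⟩), cosetCancelClass_mk b⟩
  · rintro ⟨⟨g, ρ⟩, rfl⟩
    exact ⟨_, ρ.2, rfl⟩

/-- The homomorphism on `𝒢(Υ)` that counts the positive symbols `ᵘρ` according to the image of `u`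
in `G` and the relator `ρ`, and ignores the negative ones. -/
def positiveCount (r : Set (FreeGroup X)) :
    GUpsilon r →* Multiplicative (FreeAbelianGroup (PresentedGroup r × r)) :=
  PresentedGroup.toGroup (f := fun a => if a.sign = 1 then
      Multiplicative.ofAdd (FreeAbelianGroup.of (PresentedGroup.mk r a.conj, a.rel)) else 1) <| by
    rintro _ ⟨p, q, ⟨a, b⟩, rfl⟩
    rw [map_mul, map_inv, mul_inv_eq_one]
    simp only [wordToGroup, SignedSymbol.act, SignedSymbol.mk_theta, map_mul, one_mul,
      FreeMonoid.lift_eval_of, FreeGroup.lift_apply_of]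
    exact mul_comm _ _

theorem positiveCount_symbolClass (a : SignedSymbol r) :
    positiveCount r (symbolClass a) = if a.sign = 1 then
      Multiplicative.ofAdd (FreeAbelianGroup.of (PresentedGroup.mk r a.conj, a.rel)) else 1 :=
  PresentedGroup.toGroup.of _

theorem positiveCount_cosetCancelClass (p : PresentedGroup r × r) :
    positiveCount r (cosetCancelClass p) = Multiplicative.ofAdd (FreeAbelianGroup.of p) := by
  have neg_ne_one : (-1 : ℤˣ) ≠ 1 := by decide
  simp [cosetCancelClass, cancelClass, positiveCount_symbolClass, SignedSymbol.inv, neg_ne_one,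
    Function.surjInv_eq]

end GroupPres

open GroupPres in
theorem lemma5p1_general {X : Type u} {r r₁ : Set (FreeGroup X)} (hr₁ : r₁ ⊆ r) :
    Nonempty (Additive (hatA r r₁) ≃+ FreeAbelianGroup (PresentedGroup r × r₁)) := by
  rw [hatA_eq_closure_range hr₁]
  exact nonempty_closure_range_comp_addEquiv_freeAbelianGroup (fun _ _ => commute_cancelClass _ _)
    (positiveCount r) positiveCount_cosetCancelClass
    (Function.injective_id.prodMap (Set.inclusion_injective hr₁))

theorem lemma5p1 {X : Type u} (r : Set (FreeGroup X)) (r₀ : FreeGroup X) (hr₀ : r₀ ∈ r)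
    (hasph : GroupPres.IsAspherical r) :
    Nonempty (Additive (GroupPres.hatA r (r \ {r₀})) ≃+
      FreeAbelianGroup (PresentedGroup r × (r \ {r₀} : Set (FreeGroup X)))) :=
  lemma5p1_general Set.sdiff_subset
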